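/- Let $N,K\ge 1$ be integers. For a complex polynomial $P(z)=\sum_i p_i z^i$ put $\|P\|=\max_i|p_i|$. For nonconstant complex polynomials $A,B$ let $$\delta(A,B)=\min\big(\{|A(\beta)| : B(\beta)=0\}\cup\{|B(\alpha)| : A(\alpha)=0\}\big).$$ For $A(z)=\sum_{i=0}^N a_iz^i$ of degree $N$ and $B(z)=\sum_{i=0}^K b_iz^i$ of degree $K$, let $\mathfrak S(A,B)$ be the $(N+K)\times(N+K)$ Sylvester matrix: with rows and columns indexed by $0,\dots,N+K-1$, its column $j$ for $0\le j\le K-1$ has the entries $a_0,\dots,a_N$ in rows $j,\dots,j+N$ and zeros elsewhere, and its column $K+j$ for $0\le j\le N-1$ has the entries $b_0,\dots,b_K$ in rows $j,\dots,j+K$ and zeros elsewhere. Fix any norm (or, more generally, seminorm) $\|\cdot\|$ on the space of complex $(N+K)\times(N+K)$ matrices, for example the operator norm. Then there is a constant $C_3>0$, depending only on $N$, $K$ and the chosen matrix norm, such that for all complex polynomials $A$ and $B$ of degree exactly $N$ and $K$, respectively, with $\|A\|,\|B\|\le 1$ and $\delta=\delta(A,B)>0$ (that is, without common roots), the matrix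 $\mathfrak S(A,B)$ is invertible and $$\|\mathfrak S(A,B)^{-1}\|\le \frac{C_3\,M^{N+K+\max(N,K)-1}}{\delta^2},\qquad M=\max\left(\frac{\|A\|}{|a_N|},\frac{\|B\|}{|b_K|}\right).$$ -/

import Mathlib

open Polynomial

noncomputable section

/-- The minimal modulus `δ(A, B)` of `A` at the roots of `B` and of `B` at the roots of `A`. For
nonconstant `A` and `B` the infimum is over a finite nonempty set, so it is a minimum
(see `rootSeparation_isLeast`). -/
def rootSeparation (A B : ℂ[X]) : ℝ :=
  sInf ({t : ℝ | ∃ β : ℂ, B.IsRoot β ∧ t = ‖A.eval β‖} ∪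
    {t : ℝ | ∃ α : ℂ, A.IsRoot α ∧ t = ‖B.eval α‖})

theorem rootSeparation_isLeast (A B : ℂ[X]) (hA : 1 ≤ A.natDegree) (hB : 1 ≤ B.natDegree) :
    IsLeast ({t : ℝ | ∃ β : ℂ, B.IsRoot β ∧ t = ‖A.eval β‖} ∪
      {t : ℝ | ∃ α : ℂ, A.IsRoot α ∧ t = ‖B.eval α‖}) (rootSeparation A B) := by
  have hA0 : A ≠ 0 := by rintro rfl; simp at hA
  have hB0 : B ≠ 0 := by rintro rfl; simp at hB
  have hfin : Set.Finite ({t : ℝ | ∃ β : ℂ, B.IsRoot β ∧ t = ‖A.eval β‖} ∪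
      {t : ℝ | ∃ α : ℂ, A.IsRoot α ∧ t = ‖B.eval α‖}) := by
    refine Set.Finite.union ?_ ?_
    · refine ((Polynomial.finite_setOfPred_isRoot hB0).image fun β => ‖A.eval β‖).subset ?_
      rintro t ⟨β, hβ, rfl⟩
      exact ⟨β, hβ, rfl⟩
    · refine ((Polynomial.finite_setOfPred_isRoot hA0).image fun α => ‖B.eval α‖).subset ?_
      rintro t ⟨α, hα, rfl⟩
      exact ⟨α, hα, rfl⟩
  obtain ⟨β, hβ⟩ := IsAlgClosed.exists_root B (by
    rw [Polynomial.degree_eq_natDegree hB0]; exact_mod_cast (by omega : B.natDegree ≠ 0))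
  have hne : Set.Nonempty ({t : ℝ | ∃ β : ℂ, B.IsRoot β ∧ t = ‖A.eval β‖} ∪
      {t : ℝ | ∃ α : ℂ, A.IsRoot α ∧ t = ‖B.eval α‖}) :=
    ⟨_, Or.inl ⟨β, hβ, rfl⟩⟩
  exact ⟨hne.csInf_mem hfin, fun t ht => csInf_le hfin.bddBelow ht⟩

/-- The `(N + K) × (N + K)` Sylvester matrix `𝔖(A, B)` of polynomials `A = ∑ aᵢ zⁱ` of degree `N`
and `B = ∑ bᵢ zⁱ` of degree `K`: its first `K` columns are the shifts of `(a₀, …, a_N)ᵀ` and its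
last `N` columns are the shifts of `(b₀, …, b_K)ᵀ`. In Mathlib's `Polynomial.sylvester f g` the
shifts of `g` come first, hence the order of the arguments. -/
def sylvesterMatrix (A B : ℂ[X]) (N K : ℕ) : Matrix (Fin (K + N)) (Fin (K + N)) ℂ :=
  Polynomial.sylvester B A K N

end

open Polynomial Multiset

/-! Column `k` of the inverse Sylvester matrix lists the coefficients of the `u`, `v` with `A u + B
v = X ^ k`, `deg u < K`, `deg v < N` (`bezout_of_sylvesterMatrix_inv`). So it suffices to bound `u`,
which is `X ^ k / A` modulo `B`; `v` is symmetric.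

For monic `A`, `B`, take roots `a` of `A` and `b` of `B` at maximal distance `D`. The identity `1 =
((X - b) - (X - a)) / (a - b)` expresses `u` through the solutions for `(A, B / (X - b))` and `(A /
(X - a), B)`, at the price of a factor `1 / D`. Deleting one root divides `|B(α)| |A(β)|` by at most
`D`, so a lower bound `L` for these products becomes `L / D`, which pays exactly for that factor.
Hence `exists_inverse_mod_monicOfRoots` loses only `1 / L`, and `L` is of order `δ ^ 2`. The powers
of `M` come from the roots lying in a disc of radius `2 M` (`norm_root_le`). -/

/-- The monic polynomial with a given multiset of roots. -/
noncomputable def monicOfRoots (s : Multiset ℂ) : ℂ[X] := (s.map fun a => X - C a).prod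

theorem monicOfRoots_zero : monicOfRoots 0 = 1 := by simp [monicOfRoots]

theorem monicOfRoots_cons (a : ℂ) (s : Multiset ℂ) :
    monicOfRoots (a ::ₘ s) = (X - C a) * monicOfRoots s := by simp [monicOfRoots]

/-! ### Remainders of powers modulo a monic polynomial -/

theorem degree_C_mul_le (c : ℂ) (p : ℂ[X]) : (C c * p).degree ≤ p.degree := by
  rw [← smul_eq_C_mul]
  exact degree_smul_le c p

theorem degree_X_sub_C_mul_lt {p : ℂ[X]} {n : ℕ} (b : ℂ) (hp : p.degree < n) :
    ((X - C b) * p).degree < ((n + 1 : ℕ) : WithBot ℕ) := by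
  by_cases h0 : p = 0
  · simp [h0]
  rw [degree_mul, degree_X_sub_C]
  rw [degree_eq_natDegree h0] at hp ⊢
  norm_cast at hp ⊢
  omega

/-- With the weight `R ^ i`, multiplying by `X` and by `b` each costs one factor `R`. -/
theorem norm_coeff_X_sub_C_mul_le {p : ℂ[X]} {b : ℂ} {R c : ℝ} (hR : 0 ≤ R) (hb : ‖b‖ ≤ R)
    (hp : ∀ i, ‖p.coeff i‖ * R ^ i ≤ c) (i : ℕ) :
    ‖((X - C b) * p).coeff i‖ * R ^ i ≤ 2 * R * c := by
  have h1 : ‖b * p.coeff i‖ * R ^ i ≤ R * c := by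
    rw [norm_mul, mul_assoc]
    exact mul_le_mul hb (hp i) (by positivity) hR
  have h2 : ‖(X * p).coeff i‖ * R ^ i ≤ R * c := by
    cases i with
    | zero =>
      have := (hp 0)
      simp only [mul_coeff_zero, coeff_X_zero, zero_mul, norm_zero]
      exact mul_nonneg hR (le_trans (by positivity) this)
    | succ j =>
      rw [coeff_X_mul, pow_succ, ← mul_assoc, mul_comm]
      exact mul_le_mul_of_nonneg_left (hp j) hR
  rw [sub_mul, coeff_sub, coeff_C_mul]
  calc _ ≤ (‖(X * p).coeff i‖ + ‖b * p.coeff i‖) * R ^ i := by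
        gcongr; exact norm_sub_le _ _
    _ ≤ _ := by linarith

/-- The remainder of `X ^ k` modulo a monic polynomial with roots in a disc of radius `R`. -/
theorem exists_remainder_X_pow {R : ℝ} (hR : 0 ≤ R) (k : ℕ) (t : Multiset ℂ)
    (ht : ∀ b ∈ t, ‖b‖ ≤ R) :
    ∃ r : ℂ[X], r.degree < (card t : ℕ) ∧ monicOfRoots t ∣ r - X ^ k ∧
      ∀ i, ‖r.coeff i‖ * R ^ i ≤ (3 * R) ^ k := by
  induction k generalizing t with
  | zero =>
    rcases t.empty_or_exists_mem with rfl | ⟨b, hb⟩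
    · exact ⟨0, by simp, by simp [monicOfRoots_zero], by simp⟩
    · refine ⟨1, ?_, by simp, ?_⟩
      · rw [degree_one]
        exact_mod_cast Multiset.card_pos_iff_exists_mem.2 ⟨b, hb⟩
      · rintro (_ | i) <;> simp [coeff_one]
  | succ k ih =>
    induction t using Multiset.induction with
    | empty => exact ⟨0, by simp, by simp [monicOfRoots_zero], by intro i; simp; positivity⟩
    | cons b t _ =>
      have hb : ‖b‖ ≤ R := ht b (by simp)
      obtain ⟨r, hr, ⟨q, hq⟩, hrb⟩ := ih t fun c hc => ht c (by simp [hc])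
      obtain ⟨r', hr', ⟨q', hq'⟩, hrb'⟩ := ih (b ::ₘ t) ht
      -- `X ^ (k + 1) = (X - b) X ^ k + b X ^ k`, where the first term needs only the remainder
      -- modulo the other roots. The costs `2R` and `R` add up to `3R`.
      refine ⟨(X - C b) * r + C b * r', ?_, ⟨q + C b * q', ?_⟩, fun i => ?_⟩
      · refine (degree_add_le _ _).trans_lt (max_lt ?_ ?_)
        · rw [Multiset.card_cons]; exact degree_X_sub_C_mul_lt b hr
        · exact (degree_C_mul_le _ _).trans_lt hr'
      · rw [monicOfRoots_cons] at hq' ⊢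
        linear_combination (X - C b) * hq + C b * hq'
      · have h1 := norm_coeff_X_sub_C_mul_le hR hb hrb i
        have h2 : ‖(C b * r').coeff i‖ * R ^ i ≤ R * (3 * R) ^ k := by
          rw [coeff_C_mul, norm_mul, mul_assoc]
          exact mul_le_mul hb (hrb' i) (by positivity) hR
        rw [coeff_add]
        calc _ ≤ (‖((X - C b) * r).coeff i‖ + ‖(C b * r').coeff i‖) * R ^ i := by
              gcongr; exact norm_add_le _ _
          _ ≤ _ := by rw [pow_succ]; linarith

/-! ### Inverses modulo a monic polynomial -/

theorem exists_farthest_pair {s t : Multiset ℂ} (hs : s ≠ 0) (ht : t ≠ 0) :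
    ∃ a ∈ s, ∃ b ∈ t, ∀ α ∈ s, ∀ β ∈ t, ‖α - β‖ ≤ ‖a - b‖ := by
  classical
  obtain ⟨a, ha⟩ := Multiset.exists_mem_of_ne_zero hs
  obtain ⟨b, hb⟩ := Multiset.exists_mem_of_ne_zero ht
  obtain ⟨x, hx, hmax⟩ := Finset.exists_max_image (s.toFinset ×ˢ t.toFinset)
    (fun x : ℂ × ℂ => ‖x.1 - x.2‖) ⟨(a, b), by simp [ha, hb]⟩
  simp only [Finset.mem_product, Multiset.mem_toFinset, Prod.forall] at hx hmax
  exact ⟨x.1, hx.1, x.2, hx.2, fun α hα β hβ => hmax α β ⟨hα, hβ⟩⟩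

theorem norm_eval_monicOfRoots_le {s : Multiset ℂ} {z : ℂ} {D : ℝ} (h : ∀ a ∈ s, ‖z - a‖ ≤ D) :
    ‖(monicOfRoots s).eval z‖ ≤ D ^ card s := by
  induction s using Multiset.induction with
  | empty => simp [monicOfRoots_zero]
  | cons a s ih =>
    have h0 := h a (by simp)
    rw [monicOfRoots_cons, eval_mul, norm_mul, Multiset.card_cons, pow_succ']
    have := ih fun b hb => h b (by simp [hb])
    simp only [eval_sub, eval_X, eval_C]
    exact mul_le_mul h0 this (norm_nonneg _) (le_trans (norm_nonneg _) h0)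

/-- A solution of `A u ≡ X ^ k (mod B)` for monic `A` and `B` with disjoint sets of roots `s` and
`t`, obtained by successively splitting `1 / (A B)` at the pair of roots that are farthest apart. -/
theorem exists_inverse_mod_monicOfRoots {R : ℝ} (hR : 0 ≤ R) (k n : ℕ) (s t : Multiset ℂ)
    (hn : card s + card t = n) (hs : ∀ a ∈ s, ‖a‖ ≤ R) (ht : ∀ b ∈ t, ‖b‖ ≤ R)
    (hd : ∀ a ∈ s, ∀ b ∈ t, a ≠ b) {L : ℝ} (hL0 : 0 ≤ L) (hL1 : L ≤ (2 * R) ^ n)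
    (hL : ∀ α ∈ s, ∀ β ∈ t, L ≤ ‖(monicOfRoots t).eval α‖ * ‖(monicOfRoots s).eval β‖) :
    ∃ u : ℂ[X], u.degree < (card t : ℕ) ∧ monicOfRoots t ∣ monicOfRoots s * u - X ^ k ∧
      ∀ i, ‖u.coeff i‖ * R ^ i * L ≤ 2 ^ n * (3 * R) ^ k * (2 * R) ^ card t := by
  induction n generalizing s t L with
  | zero =>
    obtain rfl : t = 0 := by rw [← Multiset.card_eq_zero]; omega
    exact ⟨0, by simp, by simp [monicOfRoots_zero], fun i => by simp; positivity⟩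
  | succ n ih =>
    rcases eq_or_ne t 0 with rfl | ht0
    · exact ⟨0, by simp, by simp [monicOfRoots_zero], fun i => by simp; positivity⟩
    rcases eq_or_ne s 0 with rfl | hs0
    · obtain ⟨r, hr, hdvd, hb⟩ := exists_remainder_X_pow hR k t ht
      refine ⟨r, hr, by simpa [monicOfRoots_zero] using hdvd, fun i => ?_⟩
      have hn' : card t = n + 1 := by simpa using hn
      rw [hn']
      -- `hL` is vacuous for empty `s`; the separate bound `hL1` on `L` replaces it.
      refine (mul_le_mul (hb i) hL1 hL0 (by positivity)).trans ?_
      rw [mul_assoc]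
      exact le_mul_of_one_le_left (by positivity) (one_le_pow₀ (by norm_num))
    obtain ⟨a, ha, b, hb, hmax⟩ := exists_farthest_pair hs0 ht0
    set D := ‖a - b‖ with hD
    have hab : a - b ≠ 0 := sub_ne_zero.2 (hd a ha b hb)
    have hDpos : 0 < D := norm_pos_iff.2 hab
    have hDR : D ≤ 2 * R := (norm_sub_le _ _).trans (by linarith [hs a ha, ht b hb])
    -- At the farthest pair all `n + 1` factors are at most `D`, so `L ≤ D ^ (n + 1)`.
    have hLD : L / D ≤ (2 * R) ^ n := by
      rw [div_le_iff₀ hDpos]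
      refine (hL a ha b hb).trans ?_
      have h1 := norm_eval_monicOfRoots_le (hmax a ha)
      have h2 := norm_eval_monicOfRoots_le (s := s) (z := b) (D := D) fun x hx => by
        rw [norm_sub_rev]; exact hmax x hx b hb
      refine (mul_le_mul h1 h2 (norm_nonneg _) (by positivity)).trans ?_
      rw [← pow_add, show card t + card s = n + 1 by omega, pow_succ]
      gcongr
    obtain ⟨s, rfl⟩ := Multiset.exists_cons_of_mem ha
    obtain ⟨t, rfl⟩ := Multiset.exists_cons_of_mem hb
    simp only [Multiset.card_cons] at hn
    obtain ⟨u, hu, ⟨q, hq⟩, hub⟩ := ih (a ::ₘ s) t (by simp; omega) hs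
      (fun c hc => ht c (by simp [hc])) (fun x hx c hc => hd x hx c (by simp [hc]))
      (L := L / D) (by positivity) hLD (by
        intro α hα β hβ
        rw [div_le_iff₀ hDpos]
        refine (hL α hα β (by simp [hβ])).trans ?_
        rw [monicOfRoots_cons b, eval_mul, norm_mul]
        have := hmax α hα b hb
        simp only [eval_sub, eval_X, eval_C]
        rw [mul_comm _ D, ← mul_assoc]
        gcongr)
    obtain ⟨v, hv, ⟨q', hq'⟩, hvb⟩ := ih s (b ::ₘ t) (by simp; omega)
      (fun c hc => hs c (by simp [hc])) ht (fun x hx c hc => hd x (by simp [hx]) c hc)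
      (L := L / D) (by positivity) hLD (by
        intro α hα β hβ
        rw [div_le_iff₀ hDpos]
        refine (hL α (by simp [hα]) β hβ).trans ?_
        rw [monicOfRoots_cons a, eval_mul, norm_mul]
        have := hmax a ha β hβ
        rw [norm_sub_rev] at this
        simp only [eval_sub, eval_X, eval_C]
        rw [mul_comm ‖β - a‖, ← mul_assoc]
        gcongr)
    refine ⟨C (a - b)⁻¹ * ((X - C b) * u - v), ?_, ⟨C (a - b)⁻¹ * (q - (X - C a) * q'), ?_⟩,
      fun i => ?_⟩
    · refine (degree_C_mul_le _ _).trans_lt ((degree_sub_le _ _).trans_lt (max_lt ?_ hv))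
      rw [Multiset.card_cons]
      exact degree_X_sub_C_mul_lt b hu
    · have hinv : C (a - b)⁻¹ * (C a - C b) = (1 : ℂ[X]) := by
        rw [← C_sub, ← C_mul, inv_mul_cancel₀ hab, C_1]
      simp only [monicOfRoots_cons] at hq hq' ⊢
      linear_combination C (a - b)⁻¹ * (X - C b) * hq - C (a - b)⁻¹ * (X - C a) * hq' +
        X ^ k * hinv
    · rcases hL0.eq_or_lt with hL' | hLpos
      · rw [← hL', mul_zero]; positivity
      have hLD0 : 0 < L / D := by positivity
      have h1 := norm_coeff_X_sub_C_mul_le hR (ht b hb) (fun j => (le_div_iff₀ hLD0).2 (hub j)) i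
      rw [← mul_div_assoc, le_div_iff₀ hLD0] at h1
      have h2 := hvb i
      rw [Multiset.card_cons] at h2 ⊢
      rw [coeff_C_mul, coeff_sub, norm_mul, norm_inv, ← hD]
      have h3 : D⁻¹ * ‖((X - C b) * u).coeff i - v.coeff i‖ * R ^ i * L ≤
          D⁻¹ * (‖((X - C b) * u).coeff i‖ + ‖v.coeff i‖) * R ^ i * L := by
        gcongr; exact norm_sub_le _ _
      have h4 : D⁻¹ * (‖((X - C b) * u).coeff i‖ + ‖v.coeff i‖) * R ^ i * L =
          ‖((X - C b) * u).coeff i‖ * R ^ i * (L / D) + ‖v.coeff i‖ * R ^ i * (L / D) := by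
        ring
      refine (h3.trans_eq h4).trans ((add_le_add h1 h2).trans_eq ?_)
      ring

/-! ### From monic to general polynomials -/

theorem eq_C_mul_monicOfRoots (A : ℂ[X]) : A = C A.leadingCoeff * monicOfRoots A.roots :=
  (IsAlgClosed.splits A).eq_prod_roots

theorem card_roots_eq_natDegree (A : ℂ[X]) : card A.roots = A.natDegree :=
  (IsAlgClosed.splits A).natDegree_eq_card_roots.symm

/-- Cauchy's bound is at most `M + 1`, hence at most `2 M`. -/
theorem norm_root_le {A : ℂ[X]} {M : ℝ} (hA : A ≠ 0) (hM : 1 ≤ M)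
    (h : A.supNorm / ‖A.leadingCoeff‖ ≤ M) {a : ℂ} (ha : A.IsRoot a) : ‖a‖ ≤ 2 * M := by
  have h1 := ha.norm_lt_cauchyBound hA
  have h2 : (A.cauchyBound : ℝ) ≤ M + 1 := by
    rw [cauchyBound, NNReal.coe_add, NNReal.coe_div, NNReal.coe_one, coe_nnnorm]
    refine add_le_add_left (le_trans ?_ h) 1
    gcongr
    rw [← Real.le_toNNReal_iff_coe_le A.supNorm_nonneg]
    refine Finset.sup_le fun i _ => ?_
    rw [Real.le_toNNReal_iff_coe_le A.supNorm_nonneg]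
    exact A.le_supNorm i
  have h3 : ‖a‖ < A.cauchyBound := by exact_mod_cast h1
  linarith

theorem isCoprime_of_rootSeparation_pos {A B : ℂ[X]} (hA : 1 ≤ A.natDegree)
    (hB : 1 ≤ B.natDegree) (h : 0 < rootSeparation A B) : IsCoprime A B := by
  rw [Polynomial.isCoprime_iff_aeval_ne_zero_of_isAlgClosed (k := ℂ) (K := ℂ)]
  intro a
  by_contra! hc
  have := (rootSeparation_isLeast A B hA hB).2 (Or.inl ⟨a, by simpa using hc.2, rfl⟩)
  have h0 : A.eval a = 0 := by simpa using hc.1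
  rw [h0, norm_zero] at this
  linarith

/-- The coefficients of the solution `u` of `A u + B v = X ^ k` are controlled by the values of `A`
and `B` at each other's roots. -/
theorem norm_coeff_bezout_le {A B u v : ℂ[X]} {N K k : ℕ} {M δ : ℝ} (hA : A.natDegree = N)
    (hB : B.natDegree = K) (hN : 1 ≤ N) (hK : 1 ≤ K) (hM : 1 ≤ M)
    (hAM : A.supNorm / ‖A.leadingCoeff‖ ≤ M) (hBM : B.supNorm / ‖B.leadingCoeff‖ ≤ M)
    (hB1 : B.supNorm ≤ 1) (hδ : 0 < δ) (hδA : ∀ α, A.IsRoot α → δ ≤ ‖B.eval α‖)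
    (hδB : ∀ β, B.IsRoot β → δ ≤ ‖A.eval β‖) (hu : u.degree < (K : ℕ))
    (huv : A * u + B * v = X ^ k) (i : ℕ) :
    ‖u.coeff i‖ ≤ 2 ^ (N + K) * (6 * M) ^ k * (4 * M) ^ K / δ ^ 2 := by
  have hA0 : A ≠ 0 := by rintro rfl; simp at hA; omega
  have hB0 : B ≠ 0 := by rintro rfl; simp at hB; omega
  have hAR : ∀ a ∈ A.roots, ‖a‖ ≤ 2 * M := fun a ha =>
    norm_root_le hA0 hM hAM (isRoot_of_mem_roots ha)
  have hBR : ∀ a ∈ B.roots, ‖a‖ ≤ 2 * M := fun a ha =>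
    norm_root_le hB0 hM hBM (isRoot_of_mem_roots ha)
  have ha0 : 0 < ‖A.leadingCoeff‖ := by simpa using hA0
  have hb0 : 0 < ‖B.leadingCoeff‖ := by simpa using hB0
  have hne : ∀ a ∈ A.roots, ∀ b ∈ B.roots, a ≠ b := by
    rintro a ha _ hb rfl
    have := hδA a (isRoot_of_mem_roots ha)
    rw [(isRoot_of_mem_roots hb).eq_zero, norm_zero] at this
    linarith
  have hcA := card_roots_eq_natDegree A
  have hcB := card_roots_eq_natDegree B
  have hevA : ∀ z, ‖A.eval z‖ = ‖A.leadingCoeff‖ * ‖(monicOfRoots A.roots).eval z‖ := fun z => by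
    conv_lhs => rw [eq_C_mul_monicOfRoots A]
    simp
  have hevB : ∀ z, ‖B.eval z‖ = ‖B.leadingCoeff‖ * ‖(monicOfRoots B.roots).eval z‖ := fun z => by
    conv_lhs => rw [eq_C_mul_monicOfRoots B]
    simp
  set L := (δ / ‖B.leadingCoeff‖) * (δ / ‖A.leadingCoeff‖) with hLdef
  have hL : ∀ α ∈ A.roots, ∀ β ∈ B.roots,
      L ≤ ‖(monicOfRoots B.roots).eval α‖ * ‖(monicOfRoots A.roots).eval β‖ := by
    intro α hα β hβ
    have h1 := hδA α (isRoot_of_mem_roots hα)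
    have h2 := hδB β (isRoot_of_mem_roots hβ)
    rw [hevB, mul_comm, ← div_le_iff₀ hb0] at h1
    rw [hevA, mul_comm, ← div_le_iff₀ ha0] at h2
    exact mul_le_mul h1 h2 (by positivity) (norm_nonneg _)
  have hL1 : L ≤ (2 * (2 * M)) ^ (N + K) := by
    obtain ⟨α, hα⟩ := Multiset.card_pos_iff_exists_mem.1 (by omega : 0 < card A.roots)
    obtain ⟨β, hβ⟩ := Multiset.card_pos_iff_exists_mem.1 (by omega : 0 < card B.roots)
    refine (hL α hα β hβ).trans ?_
    have h1 := norm_eval_monicOfRoots_le (s := B.roots) (z := α) (D := 2 * (2 * M)) fun b hb =>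
      (norm_sub_le _ _).trans (by linarith [hAR α hα, hBR b hb])
    have h2 := norm_eval_monicOfRoots_le (s := A.roots) (z := β) (D := 2 * (2 * M)) fun a ha =>
      (norm_sub_le _ _).trans (by linarith [hAR a ha, hBR β hβ])
    refine (mul_le_mul h1 h2 (norm_nonneg _) (by positivity)).trans ?_
    rw [← pow_add, hcA, hcB, hA, hB, add_comm]
  obtain ⟨w, hw, hdvd, hwb⟩ := exists_inverse_mod_monicOfRoots (R := 2 * M) (by linarith) k (N + K)
    A.roots B.roots (by omega) hAR hBR hne (L := L) (by positivity) hL1 hL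
  have hcop : IsCoprime A B := by
    rw [Polynomial.isCoprime_iff_aeval_ne_zero_of_isAlgClosed (k := ℂ) (K := ℂ)]
    intro a
    by_contra! hc
    exact hne a (by simpa [hA0] using hc.1) a (by simpa [hB0] using hc.2) rfl
  -- Both sides invert `A` modulo `B` up to `X ^ k` and have degree below `deg B`; coprimality makes
  -- them equal.
  have hwu : C A.leadingCoeff⁻¹ * w = u := by
    have hd1 : B ∣ A * (C A.leadingCoeff⁻¹ * w) - X ^ k := by
      have h1 : A * C A.leadingCoeff⁻¹ = monicOfRoots A.roots := by
        conv_lhs => enter [1]; rw [eq_C_mul_monicOfRoots A]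
        rw [mul_right_comm, ← C_mul, mul_inv_cancel₀ (norm_pos_iff.1 ha0), C_1, one_mul]
      rw [← mul_assoc, h1, eq_C_mul_monicOfRoots B]
      exact (IsUnit.mul_left_dvd (isUnit_C.2 (norm_pos_iff.1 hb0).isUnit)).2 hdvd
    have hd2 : B ∣ A * (C A.leadingCoeff⁻¹ * w - u) := by
      have : A * (C A.leadingCoeff⁻¹ * w - u) = (A * (C A.leadingCoeff⁻¹ * w) - X ^ k) + B * v := by
        rw [← huv]; ring
      rw [this]
      exact dvd_add hd1 (dvd_mul_right _ _)
    have hd3 := hcop.symm.dvd_of_dvd_mul_left hd2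
    refine sub_eq_zero.1 (eq_zero_of_dvd_of_degree_lt hd3 ?_)
    rw [degree_eq_natDegree hB0, hB]
    refine (degree_sub_le _ _).trans_lt (max_lt ((degree_C_mul_le _ _).trans_lt ?_) hu)
    rwa [hcB, hB] at hw
  have hR1 : (1 : ℝ) ≤ (2 * M) ^ i := one_le_pow₀ (by linarith)
  have hb1 : ‖B.leadingCoeff‖ ≤ 1 := (B.le_supNorm _).trans hB1
  have hwi := hwb i
  rw [hcB, hB] at hwi
  have h4 : ‖w.coeff i‖ * L ≤ 2 ^ (N + K) * (6 * M) ^ k * (4 * M) ^ K := by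
    calc ‖w.coeff i‖ * L ≤ ‖w.coeff i‖ * (2 * M) ^ i * L := by
          gcongr; exact le_mul_of_one_le_right (norm_nonneg _) hR1
      _ ≤ _ := hwi
      _ = _ := by ring_nf
  rw [← hwu, coeff_C_mul, norm_mul, norm_inv, le_div_iff₀ (by positivity)]
  -- The leading coefficient of `A` cancels against the one in `L`; that of `B` is at most `1`.
  calc ‖A.leadingCoeff‖⁻¹ * ‖w.coeff i‖ * δ ^ 2 = ‖B.leadingCoeff‖ * (‖w.coeff i‖ * L) := by
        rw [hLdef]; field_simp
    _ ≤ 1 * (‖w.coeff i‖ * L) := by gcongr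
    _ ≤ _ := by rw [one_mul]; exact h4

/-! ### The Sylvester matrix and Bézout identities -/

theorem sum_ite_coeff_eq_coeff_mul {f : ℂ[X]} {m n : ℕ} (hf : f.natDegree ≤ m) (x : Fin n → ℂ)
    (i : ℕ) :
    ∑ j : Fin n, (if i ∈ Set.Icc (j : ℕ) (j + m) then f.coeff (i - j) else 0) * x j =
      (f * ∑ j : Fin n, C (x j) * X ^ (j : ℕ)).coeff i := by
  rw [Finset.mul_sum, finsetSum_coeff]
  refine Finset.sum_congr rfl fun j _ => ?_
  rw [mul_left_comm, coeff_C_mul, coeff_mul_X_pow', mul_comm]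
  congr 1
  simp only [Set.mem_Icc]
  split_ifs with h1 h2 h2
  · rfl
  · exact absurd h1.1 h2
  · exact (coeff_eq_zero_of_natDegree_lt (by omega)).symm
  · rfl

theorem degree_sum_C_mul_X_pow_lt {n : ℕ} (x : Fin n → ℂ) :
    (∑ j : Fin n, C (x j) * X ^ (j : ℕ)).degree < ((n : ℕ) : WithBot ℕ) := by
  refine (degree_sum_le _ _).trans_lt ((Finset.sup_lt_iff (WithBot.bot_lt_coe n)).2 fun j _ => ?_)
  exact (degree_C_mul_X_pow_le _ _).trans_lt (WithBot.coe_lt_coe.2 j.2)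

theorem coeff_sum_C_mul_X_pow {n : ℕ} (x : Fin n → ℂ) (i : Fin n) :
    (∑ j : Fin n, C (x j) * X ^ (j : ℕ)).coeff i = x i := by
  rw [finsetSum_coeff, Finset.sum_eq_single i]
  · simp
  · intro j _ hj
    rw [coeff_C_mul, coeff_X_pow, if_neg (fun h => hj (Fin.ext h.symm)), mul_zero]
  · simp

theorem sylvesterMatrix_mulVec {A B : ℂ[X]} {N K : ℕ} (hA : A.natDegree = N)
    (hB : B.natDegree = K) (x : Fin (K + N) → ℂ) (i : Fin (K + N)) :
    (sylvesterMatrix A B N K).mulVec x i =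
      (A * (∑ j : Fin K, C (x (Fin.castAdd N j)) * X ^ (j : ℕ)) +
        B * (∑ j : Fin N, C (x (Fin.natAdd K j)) * X ^ (j : ℕ))).coeff i := by
  rw [coeff_add, ← sum_ite_coeff_eq_coeff_mul hA.le, ← sum_ite_coeff_eq_coeff_mul hB.le]
  simp only [Matrix.mulVec, dotProduct, Fin.sum_univ_add, sylvesterMatrix, sylvester,
    Matrix.of_apply, Fin.addCases_left, Fin.addCases_right]

theorem isUnit_sylvesterMatrix {A B : ℂ[X]} {N K : ℕ} (hA : A.natDegree = N)
    (hB : B.natDegree = K) (h : IsCoprime A B) : IsUnit (sylvesterMatrix A B N K) := by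
  rw [Matrix.isUnit_iff_isUnit_det, isUnit_iff_ne_zero]
  have := resultant_ne_zero B A h.symm
  rwa [hA, hB] at this

theorem degree_mul_lt {p q : ℂ[X]} {m n : ℕ} (hp : p.degree ≤ (m : ℕ))
    (hq : q.degree < (n : ℕ)) : (p * q).degree < ((m + n : ℕ) : WithBot ℕ) := by
  by_cases hp0 : p = 0
  · simp [hp0]
  by_cases hq0 : q = 0
  · simp [hq0]
  rw [degree_mul]
  rw [degree_eq_natDegree hp0] at hp ⊢
  rw [degree_eq_natDegree hq0] at hq ⊢
  norm_cast at hp hq ⊢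
  omega

theorem bezout_of_sylvesterMatrix_inv {A B : ℂ[X]} {N K : ℕ} (hA : A.natDegree = N)
    (hB : B.natDegree = K) (hS : IsUnit (sylvesterMatrix A B N K)) (k : Fin (K + N)) :
    A * (∑ j : Fin K, C ((sylvesterMatrix A B N K)⁻¹ (Fin.castAdd N j) k) * X ^ (j : ℕ)) +
      B * (∑ j : Fin N, C ((sylvesterMatrix A B N K)⁻¹ (Fin.natAdd K j) k) * X ^ (j : ℕ)) =
      X ^ (k : ℕ) := by
  set S := sylvesterMatrix A B N K with hSdef
  have hA0 : A.degree ≤ (N : ℕ) := hA ▸ degree_le_natDegree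
  have hB0 : B.degree ≤ (K : ℕ) := hB ▸ degree_le_natDegree
  ext i
  by_cases hi : i < K + N
  · have h := sylvesterMatrix_mulVec hA hB (fun j => S⁻¹ j k) ⟨i, hi⟩
    have h1 : S.mulVec (fun j => S⁻¹ j k) ⟨i, hi⟩ = (S * S⁻¹) ⟨i, hi⟩ k := rfl
    rw [← hSdef, h1, Matrix.mul_nonsing_inv _ ((Matrix.isUnit_iff_isUnit_det _).1 hS),
      Matrix.one_apply] at h
    rw [← h, coeff_X_pow]
    simp [Fin.ext_iff]
  -- Beyond the matrix rows both sides vanish by degree.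
  · rw [coeff_X_pow, if_neg (by omega)]
    have hAu := degree_mul_lt hA0
      (degree_sum_C_mul_X_pow_lt fun j : Fin K => S⁻¹ (Fin.castAdd N j) k)
    have hBv := degree_mul_lt hB0
      (degree_sum_C_mul_X_pow_lt fun j : Fin N => S⁻¹ (Fin.natAdd K j) k)
    rw [add_comm N K] at hAu
    refine coeff_eq_zero_of_degree_lt ((degree_add_le _ _).trans_lt ((max_lt hAu hBv).trans_le ?_))
    exact WithBot.coe_le_coe.2 (not_lt.1 hi)

/-! ### Entrywise bounds and the seminorm estimate -/

theorem exists_seminorm_le_mul_entries {n : Type*} [Fintype n] [DecidableEq n]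
    (ν : Seminorm ℂ (Matrix n n ℂ)) :
    ∃ c : ℝ, 0 < c ∧ ∀ (T : Matrix n n ℂ) (e : ℝ), (∀ i j, ‖T i j‖ ≤ e) → 0 ≤ e → ν T ≤ c * e := by
  -- The `+ 1` keeps the constant positive even for `ν = 0`.
  refine ⟨∑ i, ∑ j, ν (Matrix.single i j 1) + 1, ?_, fun T e hT he => ?_⟩
  · have : 0 ≤ ∑ i, ∑ j, ν (Matrix.single i j 1) :=
      Finset.sum_nonneg fun i _ => Finset.sum_nonneg fun j _ => apply_nonneg _ _
    linarith
  · have h1 : ν T ≤ ∑ i, ∑ j, ν (Matrix.single i j (T i j)) := by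
      conv_lhs => rw [Matrix.matrix_eq_sum_single T]
      have hsum : ∀ f : n → Matrix n n ℂ, ν (∑ i, f i) ≤ ∑ i, ν (f i) := fun f =>
        Finset.le_sum_of_subadditive ν (_root_.map_zero ν).le (map_add_le_add ν) _ f
      exact (hsum _).trans (Finset.sum_le_sum fun i _ => hsum _)
    have h2 : ∀ i j, ν (Matrix.single i j (T i j)) ≤ ν (Matrix.single i j 1) * e := by
      intro i j
      have : Matrix.single i j (T i j) = T i j • Matrix.single i j (1 : ℂ) := by
        simp
      rw [this, map_smul_eq_mul, mul_comm]
      exact mul_le_mul_of_nonneg_left (hT i j) (apply_nonneg _ _)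
    calc ν T ≤ ∑ i, ∑ j, ν (Matrix.single i j 1) * e :=
          h1.trans (Finset.sum_le_sum fun i _ => Finset.sum_le_sum fun j _ => h2 i j)
      _ = (∑ i, ∑ j, ν (Matrix.single i j 1)) * e := by simp only [Finset.sum_mul]
      _ ≤ _ := by linarith

theorem norm_sylvesterMatrix_inv_apply_le {A B : ℂ[X]} {N K : ℕ} (hN : 1 ≤ N) (hK : 1 ≤ K)
    (hA : A.natDegree = N) (hB : B.natDegree = K) (hA1 : A.supNorm ≤ 1) (hB1 : B.supNorm ≤ 1)
    (hδ : 0 < rootSeparation A B) (hS : IsUnit (sylvesterMatrix A B N K)) (i k : Fin (K + N)) :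
    ‖(sylvesterMatrix A B N K)⁻¹ i k‖ ≤ 12 ^ (3 * (N + K)) *
      max (A.supNorm / ‖A.coeff N‖) (B.supNorm / ‖B.coeff K‖) ^ (N + K + max N K - 1) /
        rootSeparation A B ^ 2 := by
  have hleast := (rootSeparation_isLeast A B (by omega) (by omega)).2
  have hδA : ∀ α, A.IsRoot α → rootSeparation A B ≤ ‖B.eval α‖ := fun α h =>
    hleast (Or.inr ⟨α, h, rfl⟩)
  have hδB : ∀ β, B.IsRoot β → rootSeparation A B ≤ ‖A.eval β‖ := fun β h =>
    hleast (Or.inl ⟨β, h, rfl⟩)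
  have hAl : A.leadingCoeff = A.coeff N := by rw [leadingCoeff, hA]
  have hBl : B.leadingCoeff = B.coeff K := by rw [leadingCoeff, hB]
  set M := max (A.supNorm / ‖A.coeff N‖) (B.supNorm / ‖B.coeff K‖)
  have hAM : A.supNorm / ‖A.leadingCoeff‖ ≤ M := by rw [hAl]; exact le_max_left _ _
  have hBM : B.supNorm / ‖B.leadingCoeff‖ ≤ M := by rw [hBl]; exact le_max_right _ _
  have hM : 1 ≤ M := by
    refine le_trans ?_ hAM
    rw [one_le_div (norm_pos_iff.2 (leadingCoeff_ne_zero.2 (by rintro rfl; simp at hA; omega)))]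
    exact A.le_supNorm _
  -- The exponent is `k + m` with `k ≤ N + K - 1` and `m ≤ max N K`; `m = K` serves `u` and `m = N`
  -- serves `v`.
  have key : ∀ m, m = N ∨ m = K → 2 ^ (N + K) * (6 * M) ^ (k : ℕ) * (4 * M) ^ m ≤
      12 ^ (3 * (N + K)) * M ^ (N + K + max N K - 1) := by
    intro m hm
    have hk := k.2
    calc (2 : ℝ) ^ (N + K) * (6 * M) ^ (k : ℕ) * (4 * M) ^ m =
          2 ^ (N + K) * 6 ^ (k : ℕ) * 4 ^ m * M ^ (k + m) := by ring
      _ ≤ 12 ^ (N + K) * 12 ^ (N + K) * 12 ^ (N + K) * M ^ (N + K + max N K - 1) := by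
        have h6 : (6 : ℝ) ^ (k : ℕ) ≤ 12 ^ (N + K) :=
          (pow_le_pow_left₀ (by norm_num) (by norm_num) _).trans
            (pow_le_pow_right₀ (by norm_num) (by omega))
        have h4 : (4 : ℝ) ^ m ≤ 12 ^ (N + K) :=
          (pow_le_pow_left₀ (by norm_num) (by norm_num) _).trans
            (pow_le_pow_right₀ (by norm_num) (by omega))
        have h2 : (2 : ℝ) ^ (N + K) ≤ 12 ^ (N + K) :=
          pow_le_pow_left₀ (by norm_num) (by norm_num) _
        have hMk : M ^ (k + m) ≤ M ^ (N + K + max N K - 1) := pow_le_pow_right₀ hM (by omega)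
        gcongr
      _ = _ := by rw [← pow_add, ← pow_add]; congr 2; ring
  have hbez := bezout_of_sylvesterMatrix_inv hA hB hS k
  induction i using Fin.addCases with
  | left i =>
    have := norm_coeff_bezout_le hA hB hN hK hM hAM hBM hB1 hδ hδA hδB
      (degree_sum_C_mul_X_pow_lt _) hbez i
    rw [coeff_sum_C_mul_X_pow (fun j => (sylvesterMatrix A B N K)⁻¹ (Fin.castAdd N j) k)] at this
    refine this.trans ?_
    gcongr ?_ / _
    exact key K (Or.inr rfl)
  | right i =>
    rw [add_comm] at hbez
    have := norm_coeff_bezout_le hB hA hK hN hM hBM hAM hA1 hδ hδB hδA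
      (degree_sum_C_mul_X_pow_lt _) hbez i
    rw [coeff_sum_C_mul_X_pow (fun j => (sylvesterMatrix A B N K)⁻¹ (Fin.natAdd K j) k)] at this
    refine this.trans ?_
    gcongr ?_ / _
    refine le_trans (le_of_eq ?_) (key N (Or.inl rfl))
    ring

theorem mainTheorem2 (N K : ℕ) (hN : 1 ≤ N) (hK : 1 ≤ K)
    (ν : Seminorm ℂ (Matrix (Fin (K + N)) (Fin (K + N)) ℂ)) :
    ∃ C₃ : ℝ, 0 < C₃ ∧
      ∀ A B : ℂ[X], A.natDegree = N → B.natDegree = K →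
        A.supNorm ≤ 1 → B.supNorm ≤ 1 → 0 < rootSeparation A B →
        IsUnit (sylvesterMatrix A B N K) ∧
        ν (sylvesterMatrix A B N K)⁻¹ ≤
          C₃ * max (A.supNorm / ‖A.coeff N‖) (B.supNorm / ‖B.coeff K‖) ^ (N + K + max N K - 1)
            / rootSeparation A B ^ 2 := by
  obtain ⟨c, hc, hν⟩ := exists_seminorm_le_mul_entries ν
  refine ⟨c * 12 ^ (3 * (N + K)), by positivity, fun A B hA hB hA1 hB1 hδ => ?_⟩
  have hS := isUnit_sylvesterMatrix hA hB
    (isCoprime_of_rootSeparation_pos (by omega) (by omega) hδ)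
  refine ⟨hS, ?_⟩
  have hent := norm_sylvesterMatrix_inv_apply_le hN hK hA hB hA1 hB1 hδ hS
  refine (hν _ _ hent ((norm_nonneg _).trans (hent ⟨0, by omega⟩ ⟨0, by omega⟩))).trans_eq ?_
  ring
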